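/- Let $h\ge 1$ and let $T$ be the uniform binary AND-OR tree of height $h$: every internal node has exactly two children, all $2^h$ leaves are at distance $h$ from the root, the root is an AND-node, and AND-layers and OR-layers alternate. A truth assignment maps the leaves to $\{0,1\}$; it determines the value of every node. A distribution is a probability measure $d$ on the set of truth assignments. It is an independent distribution (ID) if the values of the leaves are independent under $d$, and an independent identical distribution (IID) if moreover all leaves have the same probability of having the value $0$. A deterministic alpha-beta pruning algorithm is a deterministic depth-first procedure for finding the value of the root: at each internal node that it visits, it first evaluates one of the two subtrees below that node; if the value found decides the value of the node ($0$ at an AND-node, $1$ at an OR-node), the other subtree is skipped, and otherwise the other subtree is evaluated as well. All choices of order may depend on the leaf values seen so far. Its cost on a truth assignment is the number of leaves probed, and $C(A,d)$ denotes the expected cost of the algorithm $A$ when the truth assignment is drawn from $d$. Suppose that $d$ is an eigen-distribution with respect to IDs, that is, $d$ is an ID and $$\min_{A} C(A,d)=\max_{\delta}\,\min_{A} C(A,\delta),$$ where $A$ runs over all deterministic alpha-beta pruning algorithms on $T$ and $\delta$ runs over all IDs on $T$. Then $d$ is an IID. -/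

import Mathlib

open MeasureTheory ProbabilityTheory

noncomputable section

namespace AndOrTree

/-- The kind of the root of an alternating tree. -/
inductive Gate
  | and
  | or
  deriving DecidableEq

/-- The other kind of gate: the layers of the tree alternate. -/
def Gate.dual : Gate → Gate
  | .and => .or
  | .or => .and

/-- The value of a gate as a function of the values of its two children (`false` is 0, `true`
is 1). -/
def Gate.apply : Gate → Bool → Bool → Bool
  | .and => fun a b => a && b
  | .or => fun a b => a || b

/-- The value of a child that decides the value of the gate without looking at the other child:
0 for an AND-gate, 1 for an OR-gate. -/
def Gate.cut : Gate → Bool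
  | .and => false
  | .or => true

/-- The leaves of the uniform binary tree of height `h`, as paths from the root
(`false` is left, `true` is right). -/
abbrev Leaf (h : ℕ) : Type := Fin h → Bool

/-- The truth assignments to the leaves (`false` is 0, `true` is 1). -/
abbrev Assignment (h : ℕ) : Type := Leaf h → Bool

/-- A leaf of the subtree below the child `b` of the root, as a leaf of the whole tree. -/
def Leaf.below {h : ℕ} (b : Bool) (l : Leaf h) : Leaf (h + 1) := Fin.cons b l

/-- The restriction of a truth assignment to the subtree below the child `b` of the root. -/
def Assignment.sub {h : ℕ} (ω : Assignment (h + 1)) (b : Bool) : Assignment h :=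
  fun l => ω (l.below b)

/-- The value of the root of the alternating tree of height `h` whose root is a `g`-gate. -/
def value : Gate → (h : ℕ) → Assignment h → Bool
  | _, 0, ω => ω Fin.elim0
  | g, h + 1, ω => g.apply (value g.dual h (ω.sub false)) (value g.dual h (ω.sub true))

/-- The data of a deterministic depth-first search of the uniform binary tree of height `h`.
At an internal node it chooses the child `b` to be searched first, a search `first` of the subtree
below that child, and, depending on what was seen in that subtree, a search of the subtree below
the other child (carried out unless it is cut off). -/
inductive Search : ℕ → Type
  | leaf : Search 0
  | node {h : ℕ} (b : Bool) (first : Search h) (second : Assignment h → Search h) : Search (h + 1)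

/-- The set of leaves probed by a search, with alpha-beta cut-offs, on the truth assignment `ω`:
when the child searched first decides the value of the gate, the other child is skipped. -/
def Search.probed : {h : ℕ} → Gate → Search h → Assignment h → Finset (Leaf h)
  | 0, _, .leaf, _ => {Fin.elim0}
  | h + 1, g, .node b first second, ω =>
      (first.probed g.dual (ω.sub b)).image (Leaf.below b) ∪
        if value g.dual h (ω.sub b) = g.cut then ∅
        else ((second (ω.sub b)).probed g.dual (ω.sub !b)).image (Leaf.below !b)

/-- The choices of the search depend only on the values of the leaves probed so far. -/
def Search.Adapted : {h : ℕ} → Gate → Search h → Prop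
  | 0, _, .leaf => True
  | _ + 1, g, .node _ first second =>
      first.Adapted g.dual ∧ (∀ ω, (second ω).Adapted g.dual) ∧
        ∀ ω ω', (∀ l ∈ first.probed g.dual ω, ω l = ω' l) → second ω = second ω'

/-- The deterministic alpha-beta pruning algorithms (directional or not) for the alternating tree of
height `h` whose root is a `g`-gate. -/
def Algorithm (g : Gate) (h : ℕ) : Type := {A : Search h // A.Adapted g}

/-- The cost of an algorithm on a truth assignment: the number of leaves probed. -/
def Algorithm.cost {g : Gate} {h : ℕ} (A : Algorithm g h) (ω : Assignment h) : ℕ :=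
  (A.1.probed g ω).card

/-- A distribution: a probability measure on the truth assignments. -/
abbrev Distribution (h : ℕ) : Type := ProbabilityMeasure (Assignment h)

/-- The expected cost of an algorithm under a distribution. -/
def Algorithm.expectedCost {g : Gate} {h : ℕ} (A : Algorithm g h) (d : Distribution h) : ℝ :=
  ∫ ω, (A.cost ω : ℝ) ∂(d : Measure (Assignment h))

/-- The minimum of the expected cost over all algorithms (attained, see
`exists_expectedCost_eq_minCost`). -/
def minCost (g : Gate) {h : ℕ} (d : Distribution h) : ℝ :=
  ⨅ A : Algorithm g h, A.expectedCost d

/-- Independent distributions (ID): the values of the leaves are independent. -/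
def IsID {h : ℕ} (d : Distribution h) : Prop :=
  iIndepFun (fun (l : Leaf h) (ω : Assignment h) => ω l) (d : Measure (Assignment h))

/-- Independent identical distributions (IID): IDs such that all the leaves have the same
probability of having the value 0. -/
def IsIID {h : ℕ} (d : Distribution h) : Prop :=
  IsID d ∧ ∀ l l' : Leaf h, d {ω | ω l = false} = d {ω | ω l' = false}

/-- `d` is an eigen-distribution with respect to the class `B` of distributions: it belongs to `B`
and maximizes the minimum expected cost among the elements of `B`. -/
def IsEigenDistribution (g : Gate) {h : ℕ} (B : Set (Distribution h)) (d : Distribution h) : Prop :=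
  d ∈ B ∧ ∀ δ ∈ B, minCost g δ ≤ minCost g d

/-! The minimum over all algorithms is attained. -/

instance finite_search (h : ℕ) : Finite (Search h) := by
  induction h with
  | zero =>
    refine Finite.of_surjective (fun _ : Unit => Search.leaf) ?_
    intro A
    cases A
    exact ⟨(), rfl⟩
  | succ h ih =>
    refine Finite.of_surjective
      (fun x : Bool × Search h × (Assignment h → Search h) => Search.node x.1 x.2.1 x.2.2) ?_
    intro A
    cases A with
    | node b first second => exact ⟨(b, first, second), rfl⟩

instance finite_algorithm (g : Gate) (h : ℕ) : Finite (Algorithm g h) :=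
  inferInstanceAs (Finite {A : Search h // A.Adapted g})

instance nonempty_algorithm (g : Gate) (h : ℕ) : Nonempty (Algorithm g h) := by
  suffices H : ∃ A : Search h, A.Adapted g from ⟨⟨H.choose, H.choose_spec⟩⟩
  induction h generalizing g with
  | zero => exact ⟨Search.leaf, trivial⟩
  | succ h ih =>
    obtain ⟨A, hA⟩ := ih g.dual
    exact ⟨Search.node false A fun _ => A, hA, fun _ => hA, fun _ _ _ => rfl⟩

theorem exists_expectedCost_eq_minCost (g : Gate) {h : ℕ} (d : Distribution h) :
    ∃ A : Algorithm g h, A.expectedCost d = minCost g d :=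
  exists_eq_ciInf_of_finite

end AndOrTree

end

open MeasureTheory ProbabilityTheory

noncomputable section

namespace AndOrTree

/-! Under an ID the two subtrees below a node are independent, so adaptivity gains nothing and the
least cost obeys the recursion `optCost`. A child at its own cutting value leaves its parent
undecided; hence child probabilities x ≤ y combine to 1 - xy, and replacing both by s = √(xy) keeps
the law of the root.

Write G for `iidCost` at the height of the subtrees. Concavity (`exists_iidCost_le_line`) gives G(x)
+ x G(y) ≤ (1 + s) G(s), strictly if 0 < x < y (`iidCost_add_mul_lt`). So for a given root law no ID
beats the IID (`optCost_le_iidCost`), and if the root is not almost surely constant only the IID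
attains the bound (`exists_eq_const_of_optCost_eq`).

From height 2 on a maximizer has a nonconstant root, since `iidCost` exceeds both its endpoint
values somewhere. Height 1 is settled directly. -/

/-! ### Concavity and endpoint behaviour of the IID cost -/

/-- The minimum expected cost of an IID as a function of the probability that the root has the
value that cuts its own gate. -/
def iidCost : ℕ → ℝ → ℝ
  | 0, _ => 1
  | h + 1, r => (1 + √(1 - r)) * iidCost h √(1 - r)

theorem one_le_iidCost (h : ℕ) (r : ℝ) : 1 ≤ iidCost h r := by
  induction h generalizing r with
  | zero => exact le_rfl
  | succ h ih =>
    have h1 := ih √(1 - r)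
    have h2 := Real.sqrt_nonneg (1 - r)
    simp only [iidCost]
    nlinarith

theorem iidCost_pos (h : ℕ) (r : ℝ) : 0 < iidCost h r :=
  one_pos.trans_le (one_le_iidCost h r)

theorem sqrt_le_tangent {s u : ℝ} (hs : 0 < s) (hu : 0 ≤ u) :
    √u ≤ s + (u - s ^ 2) / (2 * s) := by
  have h1 := Real.sq_sqrt hu
  have h2 : s + (u - s ^ 2) / (2 * s) - √u = (√u - s) ^ 2 / (2 * s) := by
    field_simp
    nlinarith
  have h3 : 0 ≤ (√u - s) ^ 2 / (2 * s) := by positivity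
  linarith

theorem sqrt_one_sub_mem_Icc {r : ℝ} (hr : 0 ≤ r) : √(1 - r) ∈ Set.Icc (0 : ℝ) 1 :=
  ⟨Real.sqrt_nonneg _, Real.sqrt_le_one.mpr (by linarith)⟩

/-- `iidCost h` has a supporting line from above at each interior point of the unit interval. -/
theorem exists_iidCost_le_line (h : ℕ) {s : ℝ} (hs : s ∈ Set.Ioo (0 : ℝ) 1) :
    ∃ m : ℝ, ∀ x ∈ Set.Icc (0 : ℝ) 1, iidCost h x ≤ iidCost h s + m * (x - s) := by
  induction h generalizing s with
  | zero => exact ⟨0, fun x _ => by simp [iidCost]⟩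
  | succ h ih =>
    obtain ⟨hr0, hr1⟩ := hs
    set t := √(1 - s) with ht
    have ht2 : t ^ 2 = 1 - s := Real.sq_sqrt (by linarith)
    have ht0 : 0 < t := Real.sqrt_pos.mpr (by linarith)
    have ht1 : t < 1 := by nlinarith
    obtain ⟨m, hm⟩ := ih ⟨ht0, ht1⟩
    -- This is the height at 1 of the line for `iidCost h`. Being positive, it lets the tangent
    -- bound for √ be multiplied by it.
    have hK : 0 < iidCost h t + m * (1 - t) :=
      (iidCost_pos h 1).trans_le (hm 1 (by simp))
    -- With u = √(1 - x), the product of 1 + u and the line in u is a constant plus K u + m u². The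
    -- last term is affine in x with slope -m; the tangent of K u at s has slope -K / (2t).
    refine ⟨-m - (iidCost h t + m * (1 - t)) / (2 * t), fun x hx => ?_⟩
    set u := √(1 - x) with hu
    have hu2 : u ^ 2 = 1 - x := Real.sq_sqrt (by linarith [hx.2])
    have hu01 : u ∈ Set.Icc (0 : ℝ) 1 := sqrt_one_sub_mem_Icc hx.1
    have htan : u ≤ t + (1 - x - t ^ 2) / (2 * t) :=
      sqrt_le_tangent ht0 (by linarith [hx.2])
    have hG := hm u hu01
    simp only [iidCost]
    rw [← hu, ← ht]
    set G := iidCost h t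
    set K := G + m * (1 - t) with hKdef
    have e1 : (1 + u) * iidCost h u ≤ (1 + u) * (G + m * (u - t)) :=
      mul_le_mul_of_nonneg_left hG (by linarith [hu01.1])
    have e2 : K * u ≤ K * (t + (1 - x - t ^ 2) / (2 * t)) :=
      mul_le_mul_of_nonneg_left htan hK.le
    have e3 : (1 + u) * (G + m * (u - t)) = G - m * t + K * u + m * (1 - x) := by
      rw [hKdef, ← hu2]; ring
    have e4 : K * (t + (1 - x - t ^ 2) / (2 * t)) = K * t - K / (2 * t) * (x - s) := by
      rw [ht2]; ring
    have e5 : G - m * t + K * t + m * (1 - s) = (1 + t) * G := by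
      rw [hKdef, ← ht2]; ring
    nlinarith

theorem chord_le_iidCost (h : ℕ) {s : ℝ} (hs : s ∈ Set.Ioo (0 : ℝ) 1) :
    (1 - s) * iidCost h 0 + s * iidCost h 1 ≤ iidCost h s := by
  obtain ⟨m, hm⟩ := exists_iidCost_le_line h hs
  nlinarith [hm 0 (by simp), hm 1 (by simp), hs.1, hs.2]

/-- Bounding both values by the supporting line at s, the right side exceeds the left by at least (s
- x) times the height of that line at 1, which is positive. -/
theorem iidCost_add_mul_lt (h : ℕ) {x y s : ℝ} (hx : 0 < x) (hxy : x < y) (hy : y ≤ 1)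
    (hs : 0 ≤ s) (hsxy : s ^ 2 = x * y) :
    iidCost h x + x * iidCost h y < (1 + s) * iidCost h s := by
  have hxs : x < s := by nlinarith
  have hsy : s < y := by nlinarith
  obtain ⟨m, hm⟩ := exists_iidCost_le_line h (s := s) ⟨by linarith, by linarith⟩
  have h1 := hm 1 (by simp)
  have hX := hm x ⟨by linarith, by linarith⟩
  have hY := hm y ⟨by linarith, by linarith⟩
  have hG := iidCost_pos h 1
  have hK : 0 < (s - x) * (iidCost h s + m * (1 - s)) := by
    apply mul_pos <;> linarith
  have hY' := mul_le_mul_of_nonneg_left hY hx.le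
  have e : x * (iidCost h s + m * (y - s)) = x * iidCost h s + m * (s ^ 2 - x * s) := by
    rw [hsxy]; ring
  nlinarith

theorem iidCost_add_mul_le (h : ℕ) {x y s : ℝ} (hx : 0 ≤ x) (hxy : x ≤ y) (hy : y ≤ 1)
    (hs : 0 ≤ s) (hsxy : s ^ 2 = x * y) :
    iidCost h x + x * iidCost h y ≤ (1 + s) * iidCost h s := by
  rcases hx.eq_or_lt with rfl | hx
  · obtain rfl : s = 0 := by nlinarith
    simp
  rcases hxy.eq_or_lt with rfl | hxy
  · obtain rfl : s = x := by nlinarith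
    linarith
  · exact (iidCost_add_mul_lt h hx hxy hy hs hsxy).le

/-- With a, b the values of `iidCost h` at 0 and 1, the chord bound makes the gain at r = 1 - s² at
least s((1 + s)b - sa), positive for small s. -/
theorem exists_iidCost_one_lt (h : ℕ) : ∃ r ∈ Set.Icc (0 : ℝ) 1,
    iidCost (h + 1) 1 < iidCost (h + 1) r := by
  have h0 := iidCost_pos h 0
  have h1 := iidCost_pos h 1
  set s := iidCost h 1 / (iidCost h 0 + iidCost h 1) with hs
  have hs0 : 0 < s := by positivity
  have hs1 : s < 1 := by rw [hs, div_lt_one (by positivity)]; linarith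
  have hse : s * (iidCost h 0 + iidCost h 1) = iidCost h 1 := by rw [hs]; field_simp
  refine ⟨1 - s ^ 2, ⟨by nlinarith, by nlinarith⟩, ?_⟩
  have hc := chord_le_iidCost h ⟨hs0, hs1⟩
  simp only [iidCost, sub_self, Real.sqrt_zero, sub_sub_cancel, Real.sqrt_sq hs0.le]
  have := mul_le_mul_of_nonneg_left hc (by linarith : 0 ≤ 1 + s)
  nlinarith [mul_pos hs0 h1, mul_pos hs0 (mul_pos hs0 h1)]

/-- Two levels are needed: at height 1 the cost 1 + √(1 - r) is largest at r = 0. -/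
theorem exists_iidCost_zero_lt (h : ℕ) : ∃ r ∈ Set.Icc (0 : ℝ) 1,
    iidCost (h + 2) 0 < iidCost (h + 2) r := by
  have h0 := iidCost_pos h 0
  have h1 := iidCost_pos h 1
  set a := iidCost h 0 with ha
  set b := iidCost h 1 with hb
  set s := b / (4 * a + 4 * b) with hs
  have hs0 : 0 < s := by positivity
  have hs1 : s < 1 := by rw [hs, div_lt_one (by positivity)]; linarith
  have hse : s * (4 * a + 4 * b) = b := by rw [hs]; field_simp
  have hss : s ^ 2 < 1 := by nlinarith
  -- Chosen so that unfolding two levels gives the arguments 1 - s² and then s.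
  refine ⟨1 - (1 - s ^ 2) ^ 2, ⟨by nlinarith, by nlinarith⟩, ?_⟩
  have hc := chord_le_iidCost h ⟨hs0, hs1⟩
  simp only [iidCost, sub_zero, Real.sqrt_one, sub_self, Real.sqrt_zero, sub_sub_cancel,
    Real.sqrt_sq hs0.le, Real.sqrt_sq (by linarith : 0 ≤ 1 - s ^ 2)]
  have e1 := mul_le_mul_of_nonneg_left hc
    (by nlinarith : 0 ≤ (1 + (1 - s ^ 2)) * (1 + s))
  rw [← ha, ← hb] at *
  have e2 : (1 + (1 - s ^ 2)) * (1 + s) * ((1 - s) * a + s * b) - (1 + 1) * ((1 + 0) * a)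
      = s * ((2 - s ^ 2) * (1 + s) * b - 3 * (s * a)) + s ^ 4 * a := by ring
  have e3 : 3 * (s * a) < b := by nlinarith [mul_pos hs0 h0, mul_pos hs0 h1]
  have e4 : b ≤ (2 - s ^ 2) * (1 + s) * b := by
    apply le_mul_of_one_le_left h1.le; nlinarith
  have e5 : 0 < s * ((2 - s ^ 2) * (1 + s) * b - 3 * (s * a)) :=
    mul_pos hs0 (by linarith)
  have e6 : 0 < s ^ 4 * a := by positivity
  nlinarith

/-! ### Optimal cost for independent leaves, and comparison with the IID -/

/-- The probability that the root has the value that cuts its own gate, when the leaves are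
independent and `p` gives their probabilities of having the value `true`. -/
def cutProb : Gate → (h : ℕ) → (Leaf h → ℝ) → ℝ
  | .and, 0, p => 1 - p Fin.elim0
  | .or, 0, p => p Fin.elim0
  | g, h + 1, p => 1 - cutProb g.dual h (fun l => p (l.below false)) *
      cutProb g.dual h (fun l => p (l.below true))

/-- The minimum expected cost when the leaves are independent and `p` gives their probabilities
of having the value `true`. -/
def optCost : Gate → (h : ℕ) → (Leaf h → ℝ) → ℝ
  | _, 0, _ => 1
  | g, h + 1, p =>
      let c b := optCost g.dual h (fun l => p (l.below b))
      let q b := cutProb g.dual h (fun l => p (l.below b))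
      min (c false + q false * c true) (c true + q true * c false)

theorem cutProb_mem_Icc (g : Gate) {h : ℕ} {p : Leaf h → ℝ}
    (hp : ∀ l, p l ∈ Set.Icc (0 : ℝ) 1) : cutProb g h p ∈ Set.Icc (0 : ℝ) 1 := by
  induction h generalizing g with
  | zero =>
    obtain ⟨h0, h1⟩ := hp Fin.elim0
    cases g
    · exact ⟨by simpa [cutProb] using h1, by simpa [cutProb] using h0⟩
    · exact ⟨h0, h1⟩
  | succ h ih =>
    obtain ⟨a0, a1⟩ := ih g.dual (p := fun l => p (l.below false)) fun l => hp _
    obtain ⟨b0, b1⟩ := ih g.dual (p := fun l => p (l.below true)) fun l => hp _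
    rw [cutProb]
    exact ⟨by nlinarith, by nlinarith⟩

theorem optCost_succ_le (g : Gate) {h : ℕ} (p : Leaf (h + 1) → ℝ) (b : Bool) :
    optCost g (h + 1) p ≤ optCost g.dual h (fun l => p (l.below b)) +
      cutProb g.dual h (fun l => p (l.below b)) * optCost g.dual h (fun l => p (l.below !b)) := by
  cases b
  · exact min_le_left _ _
  · exact min_le_right _ _

theorem exists_optCost_succ_eq (g : Gate) {h : ℕ} (p : Leaf (h + 1) → ℝ) :
    ∃ b, optCost g (h + 1) p = optCost g.dual h (fun l => p (l.below b)) +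
      cutProb g.dual h (fun l => p (l.below b)) * optCost g.dual h (fun l => p (l.below !b)) := by
  rcases min_choice
    (optCost g.dual h (fun l => p (l.below false)) + cutProb g.dual h (fun l => p (l.below false)) *
      optCost g.dual h (fun l => p (l.below true)))
    (optCost g.dual h (fun l => p (l.below true)) + cutProb g.dual h (fun l => p (l.below true)) *
      optCost g.dual h (fun l => p (l.below false))) with H | H
  · exact ⟨false, H⟩
  · exact ⟨true, H⟩

theorem cutProb_succ (g : Gate) {h : ℕ} (p : Leaf (h + 1) → ℝ) (b : Bool) :
    cutProb g (h + 1) p = 1 - cutProb g.dual h (fun l => p (l.below b)) *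
      cutProb g.dual h (fun l => p (l.below !b)) := by
  cases b
  · rw [cutProb]; rfl
  · rw [cutProb, mul_comm]; rfl

/-- One of the two subtrees has the smaller probability of not cutting the root. -/
theorem exists_cutProb_le (g : Gate) {h : ℕ} (p : Leaf (h + 1) → ℝ) :
    ∃ b, cutProb g.dual h (fun l => p (l.below b)) ≤
      cutProb g.dual h (fun l => p (l.below !b)) := by
  rcases le_total (cutProb g.dual h (fun l => p (l.below false)))
    (cutProb g.dual h (fun l => p (l.below true))) with H | H
  · exact ⟨false, H⟩
  · exact ⟨true, H⟩

/-- It suffices to bound one order: search first the child likelier to decide the root, i.e. with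
the smaller `cutProb`. -/
theorem optCost_le_iidCost (g : Gate) {h : ℕ} {p : Leaf h → ℝ}
    (hp : ∀ l, p l ∈ Set.Icc (0 : ℝ) 1) : optCost g h p ≤ iidCost h (cutProb g h p) := by
  induction h generalizing g with
  | zero => exact le_rfl
  | succ h ih =>
    obtain ⟨b, hb⟩ := exists_cutProb_le g p
    have hq b := cutProb_mem_Icc g.dual (p := fun l => p (l.below b)) fun l => hp _
    have hc b := ih g.dual (p := fun l => p (l.below b)) fun l => hp _
    rw [cutProb_succ g p b, iidCost, sub_sub_cancel]
    calc _ ≤ _ := optCost_succ_le g p b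
      _ ≤ _ := add_le_add (hc b) (mul_le_mul_of_nonneg_left (hc !b) (hq b).1)
      _ ≤ _ := iidCost_add_mul_le h (hq b).1 hb (hq !b).2 (Real.sqrt_nonneg _)
          (Real.sq_sqrt (mul_nonneg (hq b).1 (hq !b).1))

/-- Serves to identify the constants found separately on the two subtrees. -/
theorem cutProb_const_injOn (g : Gate) (h : ℕ) :
    Set.InjOn (fun t : ℝ => cutProb g h fun _ => t) (Set.Icc 0 1) := by
  induction h generalizing g with
  | zero =>
    intro t _ u _ htu
    cases g <;> simpa [cutProb] using htu
  | succ h ih =>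
    intro t ht u hu htu
    refine ih g.dual ht hu ?_
    have h1 := (cutProb_mem_Icc g.dual (h := h) (p := fun _ => t) fun _ => ht).1
    have h2 := (cutProb_mem_Icc g.dual (h := h) (p := fun _ => u) fun _ => hu).1
    simp only [cutProb] at htu
    exact (mul_self_inj h1 h2).mp (by linarith)

theorem exists_const_optCost_eq (g : Gate) (h : ℕ) {r : ℝ} (hr : r ∈ Set.Icc (0 : ℝ) 1) :
    ∃ t ∈ Set.Icc (0 : ℝ) 1, cutProb g h (fun _ => t) = r ∧
      optCost g h (fun _ => t) = iidCost h r := by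
  induction h generalizing g r with
  | zero =>
    cases g
    · exact ⟨1 - r, ⟨by linarith [hr.2], by linarith [hr.1]⟩, by simp [cutProb], rfl⟩
    · exact ⟨r, hr, rfl, rfl⟩
  | succ h ih =>
    obtain ⟨t, ht, hq, hc⟩ := ih g.dual (sqrt_one_sub_mem_Icc hr.1)
    refine ⟨t, ht, ?_, ?_⟩
    · rw [cutProb, hq, Real.mul_self_sqrt (by linarith [hr.2])]; ring
    · simp only [optCost, hq, hc, min_self, iidCost]; ring

theorem exists_eq_const_of_optCost_eq (g : Gate) {h : ℕ} {p : Leaf h → ℝ}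
    (hp : ∀ l, p l ∈ Set.Icc (0 : ℝ) 1) (hq : cutProb g h p ∈ Set.Ioo (0 : ℝ) 1)
    (hc : optCost g h p = iidCost h (cutProb g h p)) : ∃ t, ∀ l, p l = t := by
  induction h generalizing g with
  | zero => exact ⟨p Fin.elim0, fun l => congrArg p (Subsingleton.elim _ _)⟩
  | succ h ih =>
    obtain ⟨b, hb⟩ := exists_cutProb_le g p
    have hq' b := cutProb_mem_Icc g.dual (p := fun l => p (l.below b)) fun l => hp _
    have hle b := optCost_le_iidCost g.dual (p := fun l => p (l.below b)) fun l => hp _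
    have hopt := optCost_succ_le g p b
    have hadd := mul_le_mul_of_nonneg_left (hle !b) (hq' b).1
    rw [cutProb_succ g p b] at hq hc
    rw [iidCost, sub_sub_cancel] at hc
    obtain ⟨hq0, hq1⟩ := hq
    have hpos : 0 < cutProb g.dual h (fun l => p (l.below b)) := by
      refine (hq' b).1.lt_of_ne fun H => ?_
      rw [← H] at hq1
      simp at hq1
    rcases hb.eq_or_lt with heq | hlt
    -- Equality in the sum forces equality in both subtrees; positivity of the root probability
    -- keeps their common probability below 1, so induction applies.
    · have hs1 : cutProb g.dual h (fun l => p (l.below b)) < 1 := by rw [← heq] at hq0; nlinarith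
      rw [← heq, Real.sqrt_mul_self (hq' b).1] at hc
      have hle' := hle !b
      have hb1 := hle b
      rw [← heq] at hle' hadd
      have c1 : optCost g.dual h (fun l => p (l.below b)) =
          iidCost h (cutProb g.dual h (fun l => p (l.below b))) :=
        hb1.antisymm (by linarith)
      have c2 : optCost g.dual h (fun l => p (l.below !b)) =
          iidCost h (cutProb g.dual h (fun l => p (l.below b))) :=
        hle'.antisymm (le_of_mul_le_mul_left (by linarith) hpos)
      obtain ⟨t, ht⟩ := ih g.dual (fun l => hp _) ⟨hpos, hs1⟩ c1
      obtain ⟨u, hu⟩ := ih g.dual (fun l => hp _) (heq ▸ ⟨hpos, hs1⟩) (heq ▸ c2)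
      have htu : t = u := by
        refine cutProb_const_injOn g.dual h (ht (fun _ => false) ▸ hp _)
          (hu (fun _ => false) ▸ hp _) ?_
        rw [funext ht, funext hu] at heq
        exact heq
      subst htu
      refine ⟨t, fun l => ?_⟩
      have hl : l = Leaf.below (l 0) (Fin.tail l) := (Fin.cons_self_tail l).symm
      rw [hl]
      rcases Bool.eq_or_eq_not (l 0) b with hl0 | hl0 <;> rw [hl0]
      · exact ht _
      · exact hu _
    · have := iidCost_add_mul_lt h hpos hlt (hq' !b).2 (Real.sqrt_nonneg _)
        (Real.sq_sqrt (mul_nonneg (hq' b).1 (hq' !b).1))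
      linarith [hle b]

/-- A maximizer of the minimum expected cost among the independent leaf probabilities is
constant. -/
theorem exists_eq_const_of_forall_optCost_le (g : Gate) {h : ℕ} (hh : 1 ≤ h) {p : Leaf h → ℝ}
    (hp : ∀ l, p l ∈ Set.Icc (0 : ℝ) 1)
    (hmax : ∀ t ∈ Set.Icc (0 : ℝ) 1, optCost g h (fun _ => t) ≤ optCost g h p) :
    ∃ t, ∀ l, p l = t := by
  have hG : ∀ r ∈ Set.Icc (0 : ℝ) 1, iidCost h r ≤ optCost g h p := by
    intro r hr
    obtain ⟨t, ht, -, hc⟩ := exists_const_optCost_eq g h hr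
    exact hc ▸ hmax t ht
  have hle := optCost_le_iidCost g hp
  have hq := cutProb_mem_Icc g hp
  have hc := hle.antisymm (hG _ hq)
  match h, hh with
  | 1, _ =>
    -- Here the maximum 2 sits at the endpoint r = 0: neither child may ever decide the root.
    have h2 := hG 0 (by simp)
    norm_num [iidCost, optCost] at h2
    have hleaf (l : Leaf 1) : 1 ≤ cutProb g.dual 0 fun l' => p (l'.below (l 0)) := by
      cases l 0 <;> linarith
    have hbelow (l : Leaf 1) : Leaf.below (l 0) (Fin.elim0 : Leaf 0) = l := by
      funext i; fin_cases i; rfl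
    refine ⟨match g with | .and => 1 | .or => 0, fun l => ?_⟩
    have h3 := hleaf l
    have h4 := hp l
    cases g
    · simp only [Gate.dual, cutProb, hbelow] at h3
      exact h4.2.antisymm h3
    · simp only [Gate.dual, cutProb, hbelow] at h3
      exact le_antisymm (by linarith) h4.1
  | h + 2, _ =>
    refine exists_eq_const_of_optCost_eq g hp ⟨hq.1.lt_of_ne fun H => ?_, hq.2.lt_of_ne fun H => ?_⟩
      hc
    · obtain ⟨r, hr, hlt⟩ := exists_iidCost_zero_lt h
      rw [← H] at hle
      linarith [hG r hr]
    · obtain ⟨r, hr, hlt⟩ := exists_iidCost_one_lt (h + 1)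
      rw [H] at hle
      linarith [hG r hr]

/-! ### Expected cost of searches under product weights -/

/-- The probability of a truth assignment when the leaves are independent and `p` gives their
probabilities of having the value `true`. -/
def weight {h : ℕ} (p : Leaf h → ℝ) (ω : Assignment h) : ℝ :=
  ∏ l, if ω l then p l else 1 - p l

/-- A leaf is given by the child of the root above it and a leaf of the subtree; `b` is the child
listed first. -/
def leafSumEquiv {h : ℕ} (b : Bool) : Leaf h ⊕ Leaf h ≃ Leaf (h + 1) where
  toFun := Sum.elim (Leaf.below b) (Leaf.below !b)
  invFun l := if l 0 = b then .inl (Fin.tail l) else .inr (Fin.tail l)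
  left_inv x := by
    rcases x with l | l <;> simp [Leaf.below]
  right_inv l := by
    by_cases hl : l 0 = b
    · simp only [hl, if_true, Sum.elim_inl, Leaf.below]
      rw [← hl, Fin.cons_self_tail]
    · have hl' : (!b) = l 0 := (Bool.eq_not.mpr hl).symm
      simp only [hl, if_false, Sum.elim_inr, Leaf.below]
      rw [hl', Fin.cons_self_tail]

/-- A truth assignment is given by its restrictions to the two subtrees; `b` is the child listed
first. -/
def assignmentEquiv {h : ℕ} (b : Bool) : Assignment (h + 1) ≃ Assignment h × Assignment h :=
  ((leafSumEquiv b).arrowCongr (Equiv.refl Bool)).symm.trans (Equiv.sumArrowEquivProdArrow _ _ _)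

theorem assignmentEquiv_apply {h : ℕ} (b : Bool) (ω : Assignment (h + 1)) :
    assignmentEquiv b ω = (ω.sub b, ω.sub !b) := rfl

theorem weight_succ {h : ℕ} (p : Leaf (h + 1) → ℝ) (ω : Assignment (h + 1)) (b : Bool) :
    weight p ω = weight (fun l => p (l.below b)) (ω.sub b) *
      weight (fun l => p (l.below !b)) (ω.sub !b) := by
  rw [weight, ← (leafSumEquiv b).prod_comp, Fintype.prod_sum_type]
  rfl

theorem sum_weight_succ {h : ℕ} (p : Leaf (h + 1) → ℝ) (b : Bool)
    (F : Assignment h → Assignment h → ℝ) :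
    ∑ ω : Assignment (h + 1), weight p ω * F (ω.sub b) (ω.sub !b) =
      ∑ ω, weight (fun l => p (l.below b)) ω *
        ∑ ω', weight (fun l => p (l.below !b)) ω' * F ω ω' := by
  simp_rw [Finset.mul_sum]
  rw [← Fintype.sum_prod_type', ← (assignmentEquiv b).sum_comp]
  refine Finset.sum_congr rfl fun ω _ => ?_
  rw [weight_succ p ω b, assignmentEquiv_apply]
  ring

theorem sum_weight {h : ℕ} (p : Leaf h → ℝ) : ∑ ω, weight p ω = 1 := by
  induction h with
  | zero =>
    rw [← (Equiv.funUnique (Leaf 0) Bool).symm.sum_comp]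
    simp [weight]
  | succ h ih =>
    have := sum_weight_succ p false fun _ _ => 1
    simp only [mul_one, ih] at this
    exact this

theorem weight_nonneg {h : ℕ} {p : Leaf h → ℝ} (hp : ∀ l, p l ∈ Set.Icc (0 : ℝ) 1)
    (ω : Assignment h) : 0 ≤ weight p ω :=
  Finset.prod_nonneg fun l _ => by
    split_ifs
    · exact (hp l).1
    · linarith [(hp l).2]

theorem Gate.cut_dual (g : Gate) : g.dual.cut = !g.cut := by cases g <;> rfl

theorem Gate.apply_eq_cut_iff (g : Gate) (x y : Bool) :
    g.apply x y = g.cut ↔ ¬(x ≠ g.cut ∧ y ≠ g.cut) := by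
  cases g <;> cases x <;> cases y <;> decide

theorem sum_weight_value_eq_cut (g : Gate) {h : ℕ} (p : Leaf h → ℝ) :
    ∑ ω, weight p ω * (if value g h ω = g.cut then 1 else 0) = cutProb g h p := by
  induction h generalizing g with
  | zero =>
    rw [← (Equiv.funUnique (Leaf 0) Bool).symm.sum_comp]
    cases g <;> simp [weight, value, Gate.cut, cutProb] <;>
      exact congrArg p (Subsingleton.elim _ _)
  | succ h ih =>
    -- The root misses its cutting value exactly when both children take theirs.
    have key (ω : Assignment (h + 1)) : weight p ω * (if value g (h + 1) ω = g.cut then 1 else 0) =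
        weight p ω - weight p ω *
          ((if value g.dual h (ω.sub false) = g.dual.cut then 1 else 0) *
            (if value g.dual h (ω.sub !false) = g.dual.cut then 1 else 0)) := by
      rw [value, Gate.cut_dual]
      simp only [Gate.apply_eq_cut_iff, ← Bool.eq_not, Bool.not_false]
      by_cases h1 : value g.dual h (ω.sub false) = !g.cut <;>
        by_cases h2 : value g.dual h (ω.sub true) = !g.cut <;> simp [h1, h2]
    simp_rw [key]
    rw [Finset.sum_sub_distrib, sum_weight, sum_weight_succ p false fun x y =>
      (if value g.dual h x = g.dual.cut then 1 else 0) *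
        (if value g.dual h y = g.dual.cut then 1 else 0)]
    simp_rw [mul_left_comm (weight (fun l => p (l.below !false)) _), ← Finset.mul_sum, ih,
      ← mul_assoc, ← Finset.sum_mul]
    rw [ih, cutProb]
    rfl

theorem card_probed_node (g : Gate) {h : ℕ} (b : Bool) (first : Search h)
    (second : Assignment h → Search h) (ω : Assignment (h + 1)) :
    ((Search.node b first second).probed g ω).card =
      (first.probed g.dual (ω.sub b)).card +
        (if value g.dual h (ω.sub b) = g.dual.cut then 1 else 0) *
          ((second (ω.sub b)).probed g.dual (ω.sub !b)).card := by
  have hinj (b : Bool) : Function.Injective (Leaf.below b : Leaf h → Leaf (h + 1)) :=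
    Fin.cons_right_injective (α := fun _ => Bool) b
  rw [Search.probed, Finset.card_union_of_disjoint, Finset.card_image_of_injective _ (hinj b),
    Gate.cut_dual]
  · congr 1
    by_cases hv : value g.dual h (ω.sub b) = g.cut
    · simp [hv]
    · rw [if_neg hv, if_pos (Bool.eq_not.mpr hv), Finset.card_image_of_injective _ (hinj _), one_mul]
  · rw [Finset.disjoint_left]
    intro l hl hl'
    obtain ⟨l1, -, rfl⟩ := Finset.mem_image.mp hl
    split_ifs at hl' with hv
    · simp at hl'
    · obtain ⟨l2, -, he⟩ := Finset.mem_image.mp hl'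
      have := congrFun he 0
      simp [Leaf.below] at this

theorem sum_weight_card_probed_node (g : Gate) {h : ℕ} (p : Leaf (h + 1) → ℝ) (b : Bool)
    (first : Search h) (second : Assignment h → Search h) :
    ∑ ω, weight p ω * (((Search.node b first second).probed g ω).card : ℝ) =
      ∑ ω, weight (fun l => p (l.below b)) ω * ((first.probed g.dual ω).card : ℝ) +
        ∑ ω, weight (fun l => p (l.below b)) ω *
          (if value g.dual h ω = g.dual.cut then 1 else 0) *
            ∑ ω', weight (fun l => p (l.below !b)) ω' *
              (((second ω).probed g.dual ω').card : ℝ) := by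
  simp_rw [card_probed_node]
  push_cast
  rw [sum_weight_succ p b fun x y => ((first.probed g.dual x).card : ℝ) +
    (if value g.dual h x = g.dual.cut then 1 else 0) * (((second x).probed g.dual y).card : ℝ)]
  simp_rw [mul_add, Finset.sum_add_distrib, ← Finset.sum_mul, sum_weight, one_mul,
    mul_left_comm (weight (fun l => p (l.below !b)) _), ← Finset.mul_sum, mul_add,
    Finset.sum_add_distrib, mul_assoc]

/-- Whatever was seen in the first subtree, the second keeps its product law, so each possible
second search costs at least the optimum there. -/
theorem optCost_le_sum_weight (g : Gate) {h : ℕ} {p : Leaf h → ℝ}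
    (hp : ∀ l, p l ∈ Set.Icc (0 : ℝ) 1) (A : Search h) :
    optCost g h p ≤ ∑ ω, weight p ω * ((A.probed g ω).card : ℝ) := by
  induction A generalizing g with
  | leaf => simp [Search.probed, optCost, sum_weight]
  | @node h b first second ih1 ih2 =>
    rw [sum_weight_card_probed_node]
    refine (optCost_succ_le g p b).trans (add_le_add (ih1 g.dual fun l => hp _) ?_)
    rw [← sum_weight_value_eq_cut, Finset.sum_mul]
    refine Finset.sum_le_sum fun ω _ => mul_le_mul_of_nonneg_left (ih2 ω g.dual fun l => hp _) ?_
    exact mul_nonneg (weight_nonneg (fun l => hp _) ω) (by split_ifs <;> simp)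

/-- A fixed order suffices: take the better child first, with a second search that ignores what was
seen. -/
theorem exists_sum_weight_eq_optCost (g : Gate) {h : ℕ} (p : Leaf h → ℝ) :
    ∃ A : Search h, A.Adapted g ∧
      ∑ ω, weight p ω * ((A.probed g ω).card : ℝ) = optCost g h p := by
  induction h generalizing g with
  | zero => exact ⟨.leaf, trivial, by simp [Search.probed, optCost, sum_weight]⟩
  | succ h ih =>
    obtain ⟨b, hb⟩ := exists_optCost_succ_eq g p
    obtain ⟨A, hA, hA'⟩ := ih g.dual fun l => p (l.below b)
    obtain ⟨B, hB, hB'⟩ := ih g.dual fun l => p (l.below !b)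
    refine ⟨.node b A fun _ => B, ⟨hA, fun _ => hB, fun _ _ _ => rfl⟩, ?_⟩
    rw [sum_weight_card_probed_node, hA', hb, ← Finset.sum_mul, hB', sum_weight_value_eq_cut]

/-! ### Independent distributions and their leaf probabilities -/

/-- The probability that a leaf has the value `true`. -/
def leafProb {h : ℕ} (d : Distribution h) (l : Leaf h) : ℝ :=
  (d : Measure (Assignment h)).real {ω | ω l = true}

theorem leafProb_mem_Icc {h : ℕ} (d : Distribution h) (l : Leaf h) :
    leafProb d l ∈ Set.Icc (0 : ℝ) 1 :=
  ⟨measureReal_nonneg, measureReal_le_one⟩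

theorem measureReal_eq_false {h : ℕ} (d : Distribution h) (l : Leaf h) :
    (d : Measure (Assignment h)).real {ω | ω l = false} = 1 - leafProb d l := by
  rw [leafProb, ← probReal_compl_eq_one_sub (Set.toFinite _).measurableSet]
  congr 1
  ext ω
  simp

theorem measureReal_singleton_eq_weight {h : ℕ} {d : Distribution h} (hd : IsID d)
    (ω : Assignment h) :
    (d : Measure (Assignment h)).real {ω} = weight (leafProb d) ω := by
  have hset : ({ω} : Set (Assignment h)) =
      ⋂ l ∈ Finset.univ, (fun ω' : Assignment h => ω' l) ⁻¹' {ω l} := by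
    ext ω'
    simp [funext_iff]
  rw [Measure.real, hset, hd.measure_inter_preimage_eq_mul Finset.univ
    (fun _ _ => MeasurableSet.singleton _), ENNReal.toReal_prod, weight]
  refine Finset.prod_congr rfl fun l _ => ?_
  cases hl : ω l
  · exact (measureReal_eq_false d l).trans (by simp)
  · simp [leafProb, Measure.real, Set.preimage]

theorem expectedCost_eq_sum {g : Gate} {h : ℕ} (A : Algorithm g h) {d : Distribution h}
    (hd : IsID d) :
    A.expectedCost d = ∑ ω, weight (leafProb d) ω * ((A.1.probed g ω).card : ℝ) := by
  rw [Algorithm.expectedCost, integral_fintype Integrable.of_finite]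
  simp_rw [measureReal_singleton_eq_weight hd, smul_eq_mul, Algorithm.cost]

theorem minCost_eq_optCost (g : Gate) {h : ℕ} {d : Distribution h} (hd : IsID d) :
    minCost g d = optCost g h (leafProb d) := by
  apply le_antisymm
  · obtain ⟨A, hA, hc⟩ := exists_sum_weight_eq_optCost g (leafProb d)
    rw [← hc, ← expectedCost_eq_sum ⟨A, hA⟩ hd]
    exact ciInf_le (Set.finite_range _).bddBelow _
  · refine le_ciInf fun A => ?_
    rw [expectedCost_eq_sum A hd]
    exact optCost_le_sum_weight g (leafProb_mem_Icc d) A.1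

theorem exists_isID_leafProb_eq {h : ℕ} {t : ℝ} (ht : t ∈ Set.Icc (0 : ℝ) 1) :
    ∃ d : Distribution h, IsID d ∧ leafProb d = fun _ => t := by
  let μ : Measure Bool :=
    ENNReal.ofReal t • Measure.dirac true + ENNReal.ofReal (1 - t) • Measure.dirac false
  have hμ : IsProbabilityMeasure μ := ⟨by
    simp [μ, ← ENNReal.ofReal_add ht.1 (sub_nonneg.mpr ht.2)]⟩
  refine ⟨⟨Measure.pi fun _ => μ, inferInstance⟩, ?_, ?_⟩
  · exact iIndepFun_pi (X := fun _ b => b) fun _ => measurable_id.aemeasurable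
  · funext l
    have hmp := measurePreserving_eval (fun _ : Leaf h => μ) l
    have := hmp.measure_preimage (MeasurableSet.singleton true).nullMeasurableSet
    change (Measure.pi fun _ => μ).real (Function.eval l ⁻¹' {true}) = t
    rw [Measure.real, this]
    simp [μ, ht.1]

end AndOrTree

end

theorem theorem1 (h : ℕ) (hh : 1 ≤ h) (d : AndOrTree.Distribution h)
    (hd : AndOrTree.IsEigenDistribution AndOrTree.Gate.and
      {δ : AndOrTree.Distribution h | AndOrTree.IsID δ} d) :
    AndOrTree.IsIID d := by
  obtain ⟨hID, hmax⟩ := hd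
  obtain ⟨t, ht⟩ := AndOrTree.exists_eq_const_of_forall_optCost_le .and hh
    (AndOrTree.leafProb_mem_Icc d) fun t ht => by
      obtain ⟨δ, hδ, hp⟩ := AndOrTree.exists_isID_leafProb_eq (h := h) ht
      rw [← hp, ← AndOrTree.minCost_eq_optCost _ hδ, ← AndOrTree.minCost_eq_optCost _ hID]
      exact hmax δ hδ
  refine ⟨hID, fun l l' => NNReal.eq ?_⟩
  have key (l : AndOrTree.Leaf h) := AndOrTree.measureReal_eq_false d l
  simp only [ht] at key
  exact (key l).trans (key l').symm
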